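/- Let $I^2=[0,1]\times[0,1]\subset\mathbb{R}^2$, and let $C_+(I^2,\mathbb{R})$ be the space of all positive continuous functions $\rho\colon I^2\to\mathbb{R}$ with the metric induced by the norm $\|f\|_0=\sup_{x\in I^2}|f(x)|$. A map $\phi\colon I^2\to\mathbb{R}^2$ is called bi-Lipschitz if there is $L\ge 1$ such that $\frac1L\|x-y\|\le\|\phi(x)-\phi(y)\|\le L\|x-y\|$ for all $x,y\in I^2$; such a map is differentiable almost everywhere, and $\mathrm{Jac}(\phi)=\det D\phi$ denotes its Jacobian. Let $\mathcal{C}$ be the set of all $\rho\in C_+(I^2,\mathbb{R})$ such that there is no bi-Lipschitz map $\phi\colon I^2\to\mathbb{R}^2$ with $\mathrm{Jac}(\phi)=\rho$ almost everywhere on $I^2$. Then $\mathcal{C}$ is a thick subset of $C_+(I^2,\mathbb{R})$, that is, it contains a countable intersection of open dense subsets of $C_+(I^2,\mathbb{R})$. The same holds if the Jacobian is understood without sign, as $\mathrm{Jac}(\phi)=|\det D\phi|$. -/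

import Mathlib

open MeasureTheory

/-- The Euclidean plane. -/
abbrev Plane : Type := EuclideanSpace ℝ (Fin 2)

/-- The closed unit square `I² = [0,1] × [0,1]` in the Euclidean plane. -/
def unitSquare : Set Plane := {x | ∀ i, x i ∈ Set.Icc (0 : ℝ) 1}

theorem isCompact_unitSquare : IsCompact unitSquare := by
  have h : unitSquare =
      (EuclideanSpace.equiv (Fin 2) ℝ).symm '' (Set.univ.pi fun _ => Set.Icc (0 : ℝ) 1) := by
    ext x
    constructor
    · intro hx
      exact ⟨EuclideanSpace.equiv (Fin 2) ℝ x, fun i _ => hx i, by simp⟩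
    · rintro ⟨y, hy, rfl⟩ i
      exact hy i trivial
  rw [h]
  exact (isCompact_univ_pi fun _ => isCompact_Icc).image
    (EuclideanSpace.equiv (Fin 2) ℝ).symm.continuous

/-- With this instance `C(unitSquare, ℝ)` carries the supremum norm. -/
instance instCompactSpaceUnitSquare : CompactSpace unitSquare :=
  isCompact_iff_compactSpace.mp isCompact_unitSquare

/-- The space `C₊(I², ℝ)` of positive continuous functions on the unit square, as a metric
subspace of `C(I², ℝ)` with the supremum norm. -/
abbrev PositiveDensity : Type := {ρ : C(unitSquare, ℝ) // ∀ x, 0 < ρ x}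

/-- `φ` is `L`-bi-Lipschitz on the set `s`; only the values of `φ` on `s` matter. -/
def IsBiLipschitzWithOn (L : ℝ) (φ : Plane → Plane) (s : Set Plane) : Prop :=
  ∀ x ∈ s, ∀ y ∈ s,
    1 / L * dist x y ≤ dist (φ x) (φ y) ∧ dist (φ x) (φ y) ≤ L * dist x y

/-- `φ` is bi-Lipschitz on the set `s`. -/
def IsBiLipschitzOn (φ : Plane → Plane) (s : Set Plane) : Prop :=
  ∃ L : ℝ, 1 ≤ L ∧ IsBiLipschitzWithOn L φ s

/-- `Jac φ = ρ` almost everywhere on the unit square, where `Jac φ = det Dφ`: at almost every point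
of the square, `φ` (restricted to the square) is differentiable and the determinant of its
derivative is the value of `ρ`. -/
def HasJacobianAE (φ : Plane → Plane) (ρ : unitSquare → ℝ) : Prop :=
  ∀ᵐ x : Plane, ∀ hx : x ∈ unitSquare, ∃ A : Plane →L[ℝ] Plane,
    HasFDerivWithinAt φ A unitSquare x ∧ A.det = ρ ⟨x, hx⟩

/-- The same with the unsigned Jacobian `|det Dφ|`. -/
def HasAbsJacobianAE (φ : Plane → Plane) (ρ : unitSquare → ℝ) : Prop :=
  ∀ᵐ x : Plane, ∀ hx : x ∈ unitSquare, ∃ A : Plane →L[ℝ] Plane,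
    HasFDerivWithinAt φ A unitSquare x ∧ |A.det| = ρ ⟨x, hx⟩

/-- The positive continuous densities that are not the Jacobian of a bi-Lipschitz map
`I² → ℝ²`. -/
def nonJacobian : Set PositiveDensity :=
  {ρ | ¬ ∃ φ : Plane → Plane, IsBiLipschitzOn φ unitSquare ∧ HasJacobianAE φ ρ.1}

/-- The positive continuous densities that are not the unsigned Jacobian of a bi-Lipschitz map
`I² → ℝ²`. -/
def nonAbsJacobian : Set PositiveDensity :=
  {ρ | ¬ ∃ φ : Plane → Plane, IsBiLipschitzOn φ unitSquare ∧ HasAbsJacobianAE φ ρ.1}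

/-! Fix `L`. Suppose an `L`-bi-Lipschitz `φ` stretches a horizontal segment by `A`, and no short
segment of a fine parallel family by more than `(1 + k) * A`. Then most short displacements are
nearly maximal and nearly parallel to the long one, so on some cell `φ` almost commutes with the
translation to the next cell (`exists_cell_almost_translated`). Corresponding discs in the two cells
then have images of nearly equal area (`volume_real_image_closedBall_le`, which rests on a winding
number argument).

A density oscillating from cell to cell excludes this. Hence a map realizing it stretches some short
segment by a further factor `1 + k` (`exists_insertOscillation_stretches`). As `k` does not depend
on the segment, repeating this in ever thinner strips beats the bound `L`, while the density stays
within `ε` of the original (`exists_density_forall_not_realizesDensity`).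

Densities are realized only up to an error `δ` in measure. This lets later oscillations coexist with
earlier ones, and it yields whole balls free of Jacobians of `L`-bi-Lipschitz maps. Such Jacobians
are therefore nowhere dense, and a countable union over integers `L` finishes the proof. -/

/-! ### Winding numbers by continuous logarithms. -/

/-- `f` has a continuous logarithm. -/
def HasContinuousLog {X : Type*} [TopologicalSpace X] (f : X → ℂ) : Prop :=
  ∃ l : X → ℂ, Continuous l ∧ ∀ x, Complex.exp (l x) = f x

/-- Rouché's principle: `g / f` stays in the unit disc about `1`, where the principal logarithm is
continuous. -/
theorem hasContinuousLog_iff_of_norm_sub_lt {X : Type*} [TopologicalSpace X] {f g : X → ℂ}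
    (hf : Continuous f) (hg : Continuous g) (h : ∀ x, ‖g x - f x‖ < ‖f x‖) :
    HasContinuousLog g ↔ HasContinuousLog f := by
  have hf0 : ∀ x, f x ≠ 0 := fun x hx => by
    have := h x
    rw [hx, norm_zero] at this
    exact absurd (norm_nonneg _) (not_le.mpr this)
  have hs : ∀ x, 1 + (g x - f x) / f x ∈ Complex.slitPlane := fun x => by
    apply Complex.mem_slitPlane_of_norm_lt_one
    rw [norm_div, div_lt_one (norm_pos_iff.mpr (hf0 x))]
    exact h x
  have hc : Continuous fun x => Complex.log (1 + (g x - f x) / f x) :=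
    (continuous_const.add ((hg.sub hf).div hf hf0)).clog hs
  have he : ∀ x, Complex.exp (Complex.log (1 + (g x - f x) / f x)) = g x / f x := fun x => by
    rw [Complex.exp_log (Complex.slitPlane_ne_zero (hs x))]
    field_simp [hf0 x]
    ring
  have hg0 : ∀ x, g x ≠ 0 := fun x hx => by
    have h1 := h x
    rw [hx, zero_sub, norm_neg] at h1
    exact lt_irrefl _ h1
  constructor
  · rintro ⟨l, hl, hle⟩
    refine ⟨_, hl.sub hc, fun x => ?_⟩
    rw [Pi.sub_apply, Complex.exp_sub, he, hle]
    field_simp [hf0 x, hg0 x]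
  · rintro ⟨l, hl, hle⟩
    refine ⟨_, hl.add hc, fun x => ?_⟩
    rw [Pi.add_apply, Complex.exp_add, he, hle]
    field_simp [hf0 x]

/-- By compactness of `X` and Rouché's principle the property is locally constant in the parameter,
and the interval is connected. -/
theorem hasContinuousLog_homotopy {X : Type*} [TopologicalSpace X] [CompactSpace X]
    {H : unitInterval × X → ℂ} (hH : Continuous H) (h0 : ∀ p, H p ≠ 0) (a b : unitInterval) :
    HasContinuousLog (fun x => H (a, x)) ↔ HasContinuousLog fun x => H (b, x) := by
  have hloc : IsLocallyConstant fun t : unitInterval => HasContinuousLog fun x => H (t, x) := by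
    rw [IsLocallyConstant.iff_eventually_eq]
    intro t₀
    have key : ∀ᶠ t in nhds t₀, ∀ x ∈ (Set.univ : Set X),
        ‖H (t, x) - H (t₀, x)‖ < ‖H (t₀, x)‖ := by
      apply isCompact_univ.eventually_forall_of_forall_eventually
      intro x _
      have c1 : Continuous fun z : unitInterval × X => ‖H (z.1, z.2) - H (t₀, z.2)‖ := by fun_prop
      have c2 : Continuous fun z : unitInterval × X => ‖H (t₀, z.2)‖ := by fun_prop
      exact c1.continuousAt.eventually_lt c2.continuousAt (by simpa using h0 _)
    filter_upwards [key] with t ht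
    exact propext (hasContinuousLog_iff_of_norm_sub_lt (by fun_prop) (by fun_prop)
      fun x => ht x trivial)
  exact iff_of_eq (hloc.apply_eq_of_preconnectedSpace a b)

section Sphere

variable {E : Type*} [NormedAddCommGroup E] [NormedSpace ℝ E]

/-- For a logarithm `l`, the function `l (-x) - l x` is odd and exponentiates to `-1`. On a
connected sphere its imaginary part vanishes somewhere, and there the exponential is positive. -/
theorem not_hasContinuousLog_of_odd (hE : 1 < Module.rank ℝ E)
    {f : Metric.sphere (0 : E) 1 → ℂ} (hf : ∀ x, f (-x) = -f x) : ¬ HasContinuousLog f := by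
  rintro ⟨l, hl, he⟩
  have : PreconnectedSpace (Metric.sphere (0 : E) 1) :=
    Subtype.preconnectedSpace (isPreconnected_sphere hE 0 1)
  have : Nontrivial E := (rank_pos_iff_nontrivial (R := ℝ)).mp (lt_trans zero_lt_one hE)
  obtain ⟨x₀⟩ : Nonempty (Metric.sphere (0 : E) 1) :=
    (NormedSpace.sphere_nonempty.mpr zero_le_one).to_subtype
  have hc : Continuous fun x => (l (-x) - l x).im :=
    Complex.continuous_im.comp ((hl.comp continuous_neg).sub hl)
  have hexp : ∀ x, Complex.exp (l (-x) - l x) = -1 := fun x => by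
    rw [Complex.exp_sub, he, he, hf, neg_div, div_self]
    rw [← he]
    exact Complex.exp_ne_zero _
  obtain ⟨x, hx⟩ : ∃ x, (l (-x) - l x).im = 0 := by
    rcases le_total ((l (-x₀) - l x₀).im) 0 with h | h
    · refine intermediate_value_univ₂ (a := x₀) (b := -x₀) hc continuous_const h ?_
      simp only [neg_neg, Complex.sub_im] at h ⊢
      linarith
    · refine intermediate_value_univ₂ (a := -x₀) (b := x₀) hc continuous_const ?_ h
      simp only [neg_neg, Complex.sub_im] at h ⊢
      linarith
  have h1 := congrArg Complex.re (hexp x)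
  rw [Complex.exp_re, hx, Real.cos_zero] at h1
  have := Real.exp_pos (l (-x) - l x).re
  simp at h1
  linarith [Real.exp_pos ((l (-x)).re - (l x).re)]

/-- Two homotopies lead to an odd map: `x₀` is moved to the center, then `f x - f 0` is deformed to
`f (x / 2) - f (-x / 2)`. Injectivity keeps the differences nonzero, since in the second homotopy
the two arguments always differ by `x`. -/
theorem not_hasContinuousLog_sub_of_injOn [FiniteDimensional ℝ E] (hE : 1 < Module.rank ℝ E)
    {f : E → ℂ}
    (hf : ContinuousOn f (Metric.closedBall 0 1)) (hinj : Set.InjOn f (Metric.closedBall 0 1))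
    {x₀ : E} (hx₀ : x₀ ∈ Metric.ball (0 : E) 1) :
    ¬ HasContinuousLog fun x : Metric.sphere (0 : E) 1 => f x - f x₀ := by
  have : ProperSpace E := FiniteDimensional.proper ℝ E
  have hnx : ∀ x : Metric.sphere (0 : E) 1, ‖(x : E)‖ = 1 := fun x => by simp
  have hx₀' : ‖x₀‖ < 1 := by simpa using hx₀
  have e1 : HasContinuousLog (fun x : Metric.sphere (0 : E) 1 => f x - f ((0 : ℝ) • x₀)) ↔
      HasContinuousLog fun x : Metric.sphere (0 : E) 1 => f x - f ((1 : ℝ) • x₀) := by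
    have hlt : ∀ t : unitInterval, ‖(t : ℝ) • x₀‖ < 1 := fun t => by
      rw [norm_smul, Real.norm_of_nonneg t.2.1]
      exact lt_of_le_of_lt (mul_le_of_le_one_left (norm_nonneg _) t.2.2) hx₀'
    refine hasContinuousLog_homotopy (X := Metric.sphere (0 : E) 1)
      (H := fun p => f p.2 - f ((p.1 : ℝ) • x₀)) ?_ ?_ 0 1
    · refine (hf.comp_continuous (by fun_prop) fun p => ?_).sub
        (hf.comp_continuous (by fun_prop) fun p => ?_)
      · simp
      · simpa using (hlt p.1).le
    · intro p h
      have := hinj (by simp) (by simpa using (hlt p.1).le) (sub_eq_zero.mp h)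
      have h2 := hlt p.1
      rw [← this, hnx] at h2
      exact lt_irrefl _ h2
  have e2 : HasContinuousLog (fun x : Metric.sphere (0 : E) 1 =>
        f ((1 / (1 + (0 : ℝ))) • x) - f ((-(0 : ℝ) / (1 + 0)) • (x : E))) ↔
      HasContinuousLog fun x : Metric.sphere (0 : E) 1 =>
        f ((1 / (1 + (1 : ℝ))) • x) - f ((-(1 : ℝ) / (1 + 1)) • (x : E)) := by
    have pos : ∀ t : unitInterval, (0 : ℝ) < 1 + t := fun t => by linarith [t.2.1]
    have m1 : ∀ (t : unitInterval) (x : Metric.sphere (0 : E) 1),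
        (1 / (1 + (t : ℝ))) • (x : E) ∈ Metric.closedBall (0 : E) 1 := fun t x => by
      rw [mem_closedBall_zero_iff, norm_smul, hnx, mul_one, Real.norm_eq_abs,
        abs_of_pos (one_div_pos.mpr (pos t)), div_le_one (pos t)]
      linarith [t.2.1]
    have m2 : ∀ (t : unitInterval) (x : Metric.sphere (0 : E) 1),
        (-(t : ℝ) / (1 + (t : ℝ))) • (x : E) ∈ Metric.closedBall (0 : E) 1 := fun t x => by
      rw [mem_closedBall_zero_iff, norm_smul, hnx, mul_one, Real.norm_eq_abs, abs_div,
        abs_neg, abs_of_nonneg t.2.1, abs_of_pos (pos t), div_le_one (pos t)]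
      linarith
    refine hasContinuousLog_homotopy (X := Metric.sphere (0 : E) 1)
      (H := fun p => f ((1 / (1 + (p.1 : ℝ))) • p.2) -
        f ((-(p.1 : ℝ) / (1 + p.1)) • (p.2 : E))) ?_ ?_ 0 1
    · have d : ∀ p : unitInterval × Metric.sphere (0 : E) 1, 1 + (p.1 : ℝ) ≠ 0 :=
        fun p => (pos p.1).ne'
      have c1 : Continuous fun p : unitInterval × Metric.sphere (0 : E) 1 =>
          (1 / (1 + (p.1 : ℝ))) • (p.2 : E) := by fun_prop (disch := exact d _)
      have c2 : Continuous fun p : unitInterval × Metric.sphere (0 : E) 1 =>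
          (-(p.1 : ℝ) / (1 + p.1)) • (p.2 : E) := by fun_prop (disch := exact d _)
      exact (hf.comp_continuous c1 fun p => m1 p.1 p.2).sub
        (hf.comp_continuous c2 fun p => m2 p.1 p.2)
    · intro p h
      have h1 := hinj (m1 p.1 p.2) (m2 p.1 p.2) (sub_eq_zero.mp h)
      rw [← sub_eq_zero, ← sub_smul, ← sub_div] at h1
      have h2 : (1 - -(p.1 : ℝ)) / (1 + (p.1 : ℝ)) = 1 := by
        rw [sub_neg_eq_add, div_self (pos p.1).ne']
      rw [h2, one_smul] at h1
      have := hnx p.2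
      simp [h1] at this
  rw [show (fun x : Metric.sphere (0 : E) 1 => f x - f x₀) =
    fun x : Metric.sphere (0 : E) 1 => f x - f ((1 : ℝ) • x₀) by simp, ← e1,
    show (fun x : Metric.sphere (0 : E) 1 => f x - f ((0 : ℝ) • x₀)) = _ from ?_, e2]
  · apply not_hasContinuousLog_of_odd hE
    intro x
    have e3 : (1 / (1 + (1 : ℝ))) • ((-x : Metric.sphere (0 : E) 1) : E) =
        (-(1 : ℝ) / (1 + 1)) • (x : E) := by
      simp [neg_div]
    have e4 : (-(1 : ℝ) / (1 + 1)) • ((-x : Metric.sphere (0 : E) 1) : E) =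
        (1 / (1 + (1 : ℝ))) • (x : E) := by
      simp [neg_div]
    rw [e3, e4, neg_sub]
  · simp

/-- Contracting the sphere to the center inside the ball deforms the map to a nonzero constant. -/
theorem hasContinuousLog_sub_of_notMem_image [FiniteDimensional ℝ E] {g : E → ℂ}
    (hg : ContinuousOn g (Metric.closedBall 0 1)) {y : ℂ} (hy : y ∉ g '' Metric.closedBall 0 1) :
    HasContinuousLog fun x : Metric.sphere (0 : E) 1 => g x - y := by
  have : ProperSpace E := FiniteDimensional.proper ℝ E
  have hm : ∀ (t : unitInterval) (x : Metric.sphere (0 : E) 1),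
      (t : ℝ) • (x : E) ∈ Metric.closedBall (0 : E) 1 := fun t x => by
    rw [mem_closedBall_zero_iff, norm_smul, Real.norm_of_nonneg t.2.1]
    simpa using t.2.2
  have e : HasContinuousLog (fun x : Metric.sphere (0 : E) 1 => g ((0 : ℝ) • (x : E)) - y) ↔
      HasContinuousLog fun x : Metric.sphere (0 : E) 1 => g ((1 : ℝ) • (x : E)) - y := by
    refine hasContinuousLog_homotopy (X := Metric.sphere (0 : E) 1)
      (H := fun p => g ((p.1 : ℝ) • (p.2 : E)) - y) ?_ ?_ 0 1
    · exact (hg.comp_continuous (by fun_prop) fun p : unitInterval × Metric.sphere (0 : E) 1 =>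
        hm p.1 p.2).sub continuous_const
    · intro p h
      exact hy ⟨_, hm p.1 p.2, sub_eq_zero.mp h⟩
  simp only [one_smul, zero_smul] at e
  refine e.mp ⟨fun _ => Complex.log (g 0 - y), continuous_const, fun _ => Complex.exp_log ?_⟩
  exact fun h => hy ⟨0, by simp, sub_eq_zero.mp h⟩

theorem mem_image_closedBall_of_norm_sub_lt [FiniteDimensional ℝ E] (hE : 1 < Module.rank ℝ E)
    {f g : E → ℂ}
    (hf : ContinuousOn f (Metric.closedBall 0 1)) (hinj : Set.InjOn f (Metric.closedBall 0 1))
    (hg : ContinuousOn g (Metric.closedBall 0 1)) {x₀ : E} (hx₀ : x₀ ∈ Metric.ball (0 : E) 1)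
    (h : ∀ x ∈ Metric.sphere (0 : E) 1, ‖g x - f x‖ < ‖f x - f x₀‖) :
    f x₀ ∈ g '' Metric.closedBall 0 1 := by
  by_contra hy
  refine not_hasContinuousLog_sub_of_injOn hE hf hinj hx₀ ?_
  refine (hasContinuousLog_iff_of_norm_sub_lt ?_ ?_ fun x => ?_).mp
    (hasContinuousLog_sub_of_notMem_image hg hy)
  · exact (hf.comp_continuous (by fun_prop) fun x => by simp).sub continuous_const
  · exact (hg.comp_continuous (by fun_prop) fun x => by simp).sub continuous_const
  · simpa using h x x.2

end Sphere

/-! ### Perturbations of bi-Lipschitz maps on discs. -/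

theorem IsBiLipschitzWithOn.injOn {L : ℝ} {φ : Plane → Plane} {s : Set Plane} (hL : 0 < L)
    (h : IsBiLipschitzWithOn L φ s) : Set.InjOn φ s := by
  intro x hx y hy hxy
  have := (h x hx y hy).1
  rw [hxy, dist_self] at this
  have h2 : 0 < 1 / L := by positivity
  exact dist_le_zero.mp (nonpos_of_mul_nonpos_right this h2)

theorem IsBiLipschitzWithOn.lipschitzOnWith {L : ℝ} {φ : Plane → Plane} {s : Set Plane}
    (h : IsBiLipschitzWithOn L φ s) : LipschitzOnWith L.toNNReal φ s :=
  LipschitzOnWith.of_dist_le_mul fun x hx y hy =>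
    (h x hx y hy).2.trans (mul_le_mul_of_nonneg_right (Real.le_coe_toNNReal L) dist_nonneg)

theorem IsBiLipschitzWithOn.mono {L : ℝ} {φ : Plane → Plane} {s t : Set Plane}
    (h : IsBiLipschitzWithOn L φ s) (hts : t ⊆ s) : IsBiLipschitzWithOn L φ t :=
  fun x hx y hy => h x (hts hx) y (hts hy)

/-- A point of the inner ball is more than `L * θ` away from the boundary circle, so its image is
more than `θ` away from the image of the circle, and the perturbation cannot lose this value. -/
theorem image_closedBall_subset_of_dist_le {L r θ : ℝ} {a : Plane} (hL : 0 < L) (hr : 0 < r)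
    (hθ : 0 ≤ θ) {f g : Plane → Plane} (hf : IsBiLipschitzWithOn L f (Metric.closedBall a r))
    (hg : ContinuousOn g (Metric.closedBall a r))
    (hfg : ∀ x ∈ Metric.closedBall a r, dist (g x) (f x) ≤ θ) :
    f '' Metric.closedBall a r ⊆
      g '' Metric.closedBall a r ∪ f '' (Metric.closedBall a r \ Metric.ball a (r - L * θ)) := by
  rintro _ ⟨x₀, hx₀, rfl⟩
  by_cases hb : x₀ ∈ Metric.ball a (r - L * θ)
  swap
  · exact Or.inr ⟨x₀, ⟨hx₀, hb⟩, rfl⟩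
  left
  let ι := Complex.orthonormalBasisOneI.repr.symm
  let S : Plane → Plane := fun x => a + r • x
  have hS : Set.MapsTo S (Metric.closedBall 0 1) (Metric.closedBall a r) := fun x hx => by
    have : ‖x‖ ≤ 1 := by simpa using hx
    simp only [S, Metric.mem_closedBall, dist_self_add_left, norm_smul, Real.norm_of_nonneg hr.le]
    nlinarith
  have hSc : Continuous S := by fun_prop
  have hSi : Function.Injective S := fun x y h => by
    simpa [S, hr.ne'] using h
  obtain ⟨z₀, rfl⟩ : ∃ z, S z = x₀ := ⟨r⁻¹ • (x₀ - a), by simp [S, smul_smul, hr.ne']⟩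
  have hLθ : 0 ≤ L * θ := by positivity
  have hz₀ : z₀ ∈ Metric.ball (0 : Plane) 1 := by
    have h1 : r * ‖z₀‖ < r - L * θ := by
      simpa [S, norm_smul, abs_of_pos hr] using hb
    have : r * ‖z₀‖ < r * 1 := by linarith
    simpa using lt_of_mul_lt_mul_left this hr.le
  have key := mem_image_closedBall_of_norm_sub_lt (E := Plane) (f := fun x => ι (f (S x)))
    (g := fun x => ι (g (S x))) (x₀ := z₀) ?_ ?_ ?_ ?_ hz₀ ?_
  · obtain ⟨x, hx, h⟩ := key
    exact ⟨S x, hS hx, ι.injective h⟩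
  · rw [← Module.finrank_eq_rank, finrank_euclideanSpace]
    simp
  · exact ι.continuous.comp_continuousOn
      (hf.lipschitzOnWith.continuousOn.comp hSc.continuousOn hS)
  · intro x hx y hy h
    exact hSi (hf.injOn hL (hS hx) (hS hy) (ι.injective h))
  · exact ι.continuous.comp_continuousOn (hg.comp hSc.continuousOn hS)
  · intro x hx
    have hx1 : ‖x‖ = 1 := by simpa using hx
    have hxB : S x ∈ Metric.closedBall a r := hS (Metric.sphere_subset_closedBall hx)
    rw [← map_sub, ← map_sub, LinearIsometryEquiv.norm_map, LinearIsometryEquiv.norm_map,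
      ← dist_eq_norm, ← dist_eq_norm]
    refine (hfg _ hxB).trans_lt (lt_of_lt_of_le ?_ (hf _ hxB _ hx₀).1)
    have h1 : dist (S x) a = r := by simp [S, norm_smul, hx1, abs_of_pos hr]
    have h2 : dist (S z₀) a < r - L * θ := hb
    have h3 : L * θ < dist (S x) (S z₀) := by
      linarith [dist_triangle (S x) (S z₀) a]
    rw [one_div, ← div_eq_inv_mul, lt_div_iff₀ hL]
    linarith

/-! ### Image measures and densities. -/

/-- The image measure of `φ` agrees up to `δ` with the density `ρ` on measurable subsets of the
unit square. -/
def RealizesDensity (δ : ℝ) (ρ : Plane → ℝ) (φ : Plane → Plane) : Prop :=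
  ∀ E ⊆ unitSquare, MeasurableSet E → |volume.real (φ '' E) - ∫ x in E, ρ x| ≤ δ

/-- Lipschitz maps control two-dimensional Hausdorff measure, which has the same null sets as
Lebesgue measure because both are Haar measures. -/
theorem measure_image_eq_zero_of_lipschitzOnWith {φ : Plane → Plane} {K : NNReal} {s : Set Plane}
    (hφ : LipschitzOnWith K φ s) (hs : volume s = 0) : volume (φ '' s) = 0 := by
  have hH : Measure.IsAddHaarMeasure (μH[(2 : ℝ)] : Measure Plane) := by
    have := isAddHaarMeasure_hausdorffMeasure (E := Plane)
    rwa [finrank_euclideanSpace, Fintype.card_fin, Nat.cast_ofNat] at this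
  have h0 : μH[(2 : ℝ)] s = 0 :=
    Measure.absolutelyContinuous_isAddHaarMeasure (μH[(2 : ℝ)] : Measure Plane) volume hs
  apply Measure.absolutelyContinuous_isAddHaarMeasure volume (μH[(2 : ℝ)] : Measure Plane)
  have := hφ.hausdorffMeasure_image_le (d := 2) (by norm_num)
  rw [h0, mul_zero] at this
  exact le_antisymm this zero_le

/-- The area formula for injective maps applies off a null set, whose image is null as well. -/
theorem realizesDensity_of_hasAbsJacobianAE {φ : Plane → Plane} {L : ℝ} (hL : 0 < L)
    (hφ : IsBiLipschitzWithOn L φ unitSquare) {ρ : unitSquare → ℝ} (hJ : HasAbsJacobianAE φ ρ)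
    {σ : Plane → ℝ} (hσ : Continuous σ) (h : ∀ x : unitSquare, σ x = ρ x) :
    RealizesDensity 0 σ φ := by
  intro E hE hEm
  set N := toMeasurable volume
    {x : Plane | ¬ ∀ hx : x ∈ unitSquare, ∃ A : Plane →L[ℝ] Plane,
      HasFDerivWithinAt φ A unitSquare x ∧ |A.det| = ρ ⟨x, hx⟩} with hN
  have hN0 : volume N = 0 := by
    rw [hN, measure_toMeasurable]
    exact hJ
  have hNm : MeasurableSet N := measurableSet_toMeasurable _ _
  have hgood : ∀ x, ∃ A : Plane →L[ℝ] Plane, x ∈ E \ N →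
      HasFDerivWithinAt φ A unitSquare x ∧ |A.det| = σ x := by
    intro x
    by_cases hx : x ∈ E \ N
    · have h1 : ∀ hx : x ∈ unitSquare, ∃ A : Plane →L[ℝ] Plane,
          HasFDerivWithinAt φ A unitSquare x ∧ |A.det| = ρ ⟨x, hx⟩ := by
        by_contra hc
        exact hx.2 (subset_toMeasurable _ _ hc)
      obtain ⟨A, hA, hA'⟩ := h1 (hE hx.1)
      exact ⟨A, fun _ => ⟨hA, by rw [hA', ← h]⟩⟩
    · exact ⟨0, fun h => absurd h hx⟩
  choose A hA using hgood
  have hnn : ∀ x ∈ E \ N, 0 ≤ σ x := fun x hx => (hA x hx).2 ▸ abs_nonneg _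
  have hae : (E \ N : Set Plane) =ᵐ[volume] E := by
    refine sdiff_null_ae_eq_self hN0
  have harea := lintegral_abs_det_fderiv_eq_addHaar_image volume (hEm.diff hNm)
    (fun x hx => (hA x hx).1.mono (Set.sdiff_subset.trans hE))
    ((hφ.injOn hL).mono (Set.sdiff_subset.trans hE))
  have himg : volume (φ '' E) = volume (φ '' (E \ N)) := by
    refine le_antisymm ?_ (measure_mono (Set.image_mono Set.sdiff_subset))
    calc volume (φ '' E) ≤ volume (φ '' (E \ N) ∪ φ '' (E ∩ N)) := by
          rw [← Set.image_union, Set.sdiff_union_inter]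
      _ ≤ volume (φ '' (E \ N)) + volume (φ '' (E ∩ N)) := measure_union_le _ _
      _ = volume (φ '' (E \ N)) := by
          rw [measure_image_eq_zero_of_lipschitzOnWith
            (hφ.lipschitzOnWith.mono (Set.inter_subset_left.trans hE))
            (measure_mono_null Set.inter_subset_right hN0), add_zero]
  have hint : ∫ x in E, σ x = volume.real (φ '' E) := by
    rw [← setIntegral_congr_set hae, integral_eq_lintegral_of_nonneg_ae
      ((ae_restrict_iff' (hEm.diff hNm)).mpr (Filter.Eventually.of_forall hnn))
      hσ.aestronglyMeasurable, Measure.real, himg, ← harea]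
    congr 1
    exact setLIntegral_congr_fun (hEm.diff hNm) fun x hx => by simp only [(hA x hx).2]
  rw [hint, sub_self, abs_zero]

theorem volume_unitSquare_lt_top : volume unitSquare < ⊤ := isCompact_unitSquare.measure_lt_top

theorem integrableOn_of_continuous_of_subset_unitSquare {ρ : Plane → ℝ} (hρ : Continuous ρ)
    {E : Set Plane} (hE : E ⊆ unitSquare) : IntegrableOn ρ E :=
  (hρ.continuousOn.integrableOn_compact isCompact_unitSquare).mono_set hE

theorem IsBiLipschitzWithOn.volume_image_ne_top {L : ℝ} {φ : Plane → Plane}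
    (hφ : IsBiLipschitzWithOn L φ unitSquare) {E : Set Plane} (hE : E ⊆ unitSquare) :
    volume (φ '' E) ≠ ⊤ :=
  ((measure_mono (Set.image_mono hE)).trans_lt
    (isCompact_unitSquare.image_of_continuousOn
      hφ.lipschitzOnWith.continuousOn).measure_lt_top).ne

/-- Densities differing by at most `c` on the measurable part `S` of the unit square and equal
elsewhere are realized by the same maps up to `c * volume S`. -/
theorem RealizesDensity.of_abs_sub_le {δ c : ℝ} {ρ σ : Plane → ℝ} {φ : Plane → Plane}
    (h : RealizesDensity δ ρ φ) (hρ : Continuous ρ) (hσ : Continuous σ) {S : Set Plane}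
    (hc : 0 ≤ c) (hle : ∀ x ∈ unitSquare ∩ S, |ρ x - σ x| ≤ c)
    (heq : ∀ x ∈ unitSquare \ S, ρ x = σ x) :
    RealizesDensity (δ + c * volume.real (unitSquare ∩ S)) σ φ := by
  intro E hE hEm
  have h1 := h E hE hEm
  have iρ := integrableOn_of_continuous_of_subset_unitSquare hρ hE
  have iσ := integrableOn_of_continuous_of_subset_unitSquare hσ hE
  have hfin : volume (unitSquare ∩ S) < ⊤ :=
    (measure_mono Set.inter_subset_left).trans_lt volume_unitSquare_lt_top
  have h2 : |(∫ x in E, ρ x) - ∫ x in E, σ x| ≤ c * volume.real (unitSquare ∩ S) := by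
    rw [← integral_sub iρ iσ, setIntegral_eq_of_subset_of_forall_sdiff_eq_zero hEm
      (Set.inter_subset_left : E ∩ S ⊆ E) ?_, ← Real.norm_eq_abs]
    · refine (norm_setIntegral_le_of_norm_le_const
        ((measure_mono (Set.inter_subset_inter_left S hE)).trans_lt hfin)
        fun x hx => hle x ⟨hE hx.1, hx.2⟩).trans ?_
      exact mul_le_mul_of_nonneg_left
        (measureReal_mono (Set.inter_subset_inter_left S hE) hfin.ne) hc
    · intro x hx
      exact sub_eq_zero.mpr (heq x ⟨hE hx.1, fun hxS => hx.2 ⟨hx.1, hxS⟩⟩)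
  have := abs_sub_le (volume.real (φ '' E)) (∫ x in E, ρ x) (∫ x in E, σ x)
  linarith

/-- The volume of the horizontal strip of height `4 * h` in the unit square. -/
theorem volume_real_strip_le {c h : ℝ} (hh : 0 ≤ h) :
    volume.real (unitSquare ∩ {x | |x 1 - c| ≤ 2 * h}) ≤ 4 * h := by
  have hsub : unitSquare ∩ {x : Plane | |x 1 - c| ≤ 2 * h} ⊆
      WithLp.ofLp ⁻¹' (Set.univ.pi ![Set.Icc (0 : ℝ) 1, Set.Icc (c - 2 * h) (c + 2 * h)]) := by
    rintro x ⟨hx, hx'⟩ i -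
    rw [Set.mem_ofPred_eq, abs_le] at hx'
    fin_cases i
    · exact hx 0
    · exact ⟨by simp; linarith, by simp; linarith⟩
  have hm : MeasurableSet
      (Set.univ.pi ![Set.Icc (0 : ℝ) 1, Set.Icc (c - 2 * h) (c + 2 * h)]) := by
    refine MeasurableSet.univ_pi fun i => ?_
    fin_cases i <;> exact measurableSet_Icc
  have hv : volume (WithLp.ofLp ⁻¹' (Set.univ.pi
      ![Set.Icc (0 : ℝ) 1, Set.Icc (c - 2 * h) (c + 2 * h)]) : Set Plane) =
      ENNReal.ofReal (4 * h) := by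
    rw [(PiLp.volume_preserving_ofLp (Fin 2)).measure_preimage hm.nullMeasurableSet,
      volume_pi_pi]
    rw [Fin.prod_univ_two]
    simp only [Matrix.cons_val_zero, Matrix.cons_val_one, Real.volume_Icc, sub_zero,
      ENNReal.ofReal_one, one_mul]
    congr 1
    ring
  refine ENNReal.toReal_le_of_le_ofReal (by positivity) ?_
  rw [← hv]
  exact measure_mono hsub

/-! ### Rows of cells and almost translated cells. -/

/-- The first coordinate vector of the plane. -/
noncomputable def horizontal : Plane := EuclideanSpace.single 0 1

@[simp] theorem horizontal_apply_zero : horizontal 0 = 1 := by simp [horizontal]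

@[simp] theorem horizontal_apply_one : horizontal 1 = 0 := by simp [horizontal]

@[simp] theorem norm_horizontal : ‖horizontal‖ = 1 := by simp [horizontal]

/-- The point with local coordinates `z` in the `i`-th cell of a row of squares of side `h`
starting at `p`. -/
noncomputable def cellPoint (p : Plane) (h : ℝ) (i : ℕ) (z : Plane) : Plane :=
  p + h • ((i : ℝ) • horizontal + z)

theorem cellPoint_add_horizontal (p : Plane) (h : ℝ) (i : ℕ) (z : Plane) :
    cellPoint p h i (z + horizontal) = cellPoint p h (i + 1) z := by
  simp only [cellPoint]
  push_cast
  module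

theorem dist_cellPoint {h : ℝ} (hh : 0 ≤ h) (p : Plane) (i : ℕ) (z w : Plane) :
    dist (cellPoint p h i z) (cellPoint p h i w) = h * dist z w := by
  simp [cellPoint, dist_smul₀, abs_of_nonneg hh]

theorem cellPoint_apply_zero (p : Plane) (h : ℝ) (i : ℕ) (z : Plane) :
    cellPoint p h i z 0 = p 0 + h * (i + z 0) := by
  simp [cellPoint, mul_add]

theorem cellPoint_apply_one (p : Plane) (h : ℝ) (i : ℕ) (z : Plane) :
    cellPoint p h i z 1 = p 1 + h * z 1 := by
  simp [cellPoint]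

theorem cellPoint_mem_unitSquare {p : Plane} {h : ℝ} {n i : ℕ} {z : Plane} (hh : 0 ≤ h)
    (h0 : 0 ≤ p 0) (h0' : p 0 + (n + 1) * h ≤ 1) (h1 : 0 ≤ p 1) (h1' : p 1 + h ≤ 1) (hi : i ≤ n)
    (hz : z ∈ unitSquare) : cellPoint p h i z ∈ unitSquare := by
  have hi' : (i : ℝ) ≤ n := by exact_mod_cast hi
  have hi0 : (0 : ℝ) ≤ i := by positivity
  have z0 := hz 0
  have z1 := hz 1
  rw [Set.mem_Icc] at z0 z1
  rw [unitSquare, Set.mem_ofPred_eq, Fin.forall_fin_two, cellPoint_apply_zero,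
    cellPoint_apply_one, Set.mem_Icc, Set.mem_Icc]
  refine ⟨⟨?_, ?_⟩, ?_, ?_⟩
  · have := mul_nonneg hh (add_nonneg hi0 z0.1)
    linarith
  · have := mul_le_mul_of_nonneg_left (add_le_add hi' z0.2) hh
    linarith
  · have := mul_nonneg hh z1.1
    linarith
  · have := mul_le_mul_of_nonneg_left z1.2 hh
    linarith

theorem zero_mem_unitSquare : (0 : Plane) ∈ unitSquare := fun i => by simp

theorem horizontal_mem_unitSquare : horizontal ∈ unitSquare := by
  rw [unitSquare, Set.mem_ofPred_eq, Fin.forall_fin_two]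
  simp

theorem dist_le_two_of_mem_unitSquare {x y : Plane} (hx : x ∈ unitSquare) (hy : y ∈ unitSquare) :
    dist x y ≤ 2 := by
  rw [EuclideanSpace.dist_eq, Fin.sum_univ_two, Real.sqrt_le_left (by norm_num)]
  have h : ∀ i, dist (x i) (y i) ^ 2 ≤ 1 := fun i => by
    have := Real.dist_le_of_mem_Icc_01 (hx i) (hy i)
    exact pow_le_one₀ dist_nonneg this
  linarith [h 0, h 1]

/-- A vector of norm at most `b` whose component along `u` is almost `b` must be close to `b • u`.
-/
theorem norm_sub_smul_sq_le {V : Type*} [NormedAddCommGroup V] [InnerProductSpace ℝ V]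
    {u w : V} {b d : ℝ} (hu : ‖u‖ = 1) (hw : ‖w‖ ≤ b) (hd : b - inner ℝ w u ≤ d) :
    ‖w - b • u‖ ^ 2 ≤ 2 * b * d := by
  have hb : 0 ≤ b := (norm_nonneg w).trans hw
  rw [norm_sub_sq_real, inner_smul_right, norm_smul, hu, Real.norm_of_nonneg hb]
  nlinarith [mul_le_mul_of_nonneg_left hd hb, pow_le_pow_left₀ (norm_nonneg w) hw 2]

/-- Averaging over `i` the sum over all of `G` gives one index that serves every `g` at once. -/
theorem exists_forall_le_of_sum_sum_le {ι : Type*} {n : ℕ} (hn : 0 < n) {G : Finset ι}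
    {d : ℕ → ι → ℝ} {c : ℝ} (hd : ∀ i < n, ∀ g ∈ G, 0 ≤ d i g)
    (hs : ∀ g ∈ G, ∑ i ∈ Finset.range n, d i g ≤ n * c) :
    ∃ i < n, ∀ g ∈ G, d i g ≤ G.card * c := by
  have h : ∑ i ∈ Finset.range n, ∑ g ∈ G, d i g ≤ ∑ _i ∈ Finset.range n, G.card * c := by
    rw [Finset.sum_comm]
    refine (Finset.sum_le_sum hs).trans_eq ?_
    simp only [Finset.sum_const, Finset.card_range, nsmul_eq_mul]
    ring
  obtain ⟨i, hi, hle⟩ := Finset.exists_le_of_sum_le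
    (Finset.nonempty_range_iff.mpr hn.ne') h
  rw [Finset.mem_range] at hi
  exact ⟨i, hi, fun g hg =>
    (Finset.single_le_sum (f := fun g => d i g) (fun g hg => hd i hi g hg) hg).trans hle⟩

/-- If no horizontal segment of a fine finite family is stretched much more than the long one,
then on some cell the map almost commutes with the translation to the next cell. -/
theorem exists_cell_almost_translated {L θ : ℝ} (hL : 1 ≤ L) (hθ : 0 < θ) :
    ∃ k > 0, ∃ G : Finset Plane, ↑G ⊆ unitSquare ∧ ∃ n₀ : ℕ, ∀ n ≥ n₀, ∀ (p : Plane) (h : ℝ)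
      (φ : Plane → Plane), 0 < h → 0 ≤ p 0 → p 0 + (n + 1) * h ≤ 1 → 0 ≤ p 1 → p 1 + h ≤ 1 →
      IsBiLipschitzWithOn L φ unitSquare → ∀ A : ℝ,
      dist (φ (cellPoint p h (n + 1) 0)) (φ (cellPoint p h 0 0)) = A * ((n + 1) * h) →
      (∀ i < n, ∀ g ∈ G, dist (φ (cellPoint p h (i + 1) g)) (φ (cellPoint p h i g)) ≤
        (1 + k) * A * h) →
      ∃ i < n, ∃ v : Plane, ∀ z ∈ unitSquare,
        ‖φ (cellPoint p h (i + 1) z) - φ (cellPoint p h i z) - v‖ ≤ θ * h := by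
  have hL0 : 0 < L := by linarith
  -- With this mesh, replacing `z` by a net point costs `θ / 4 * h` in each of the two cells, which
  -- leaves `θ / 2 * h` for the net itself.
  obtain ⟨G', hG's, hG'f, hcov⟩ := isCompact_unitSquare.finite_cover_balls
    (e := θ / (4 * L)) (by positivity)
  lift G' to Finset Plane using hG'f with G
  set m : ℝ := G.card + 1 with hm
  have hm0 : 0 < m := by positivity
  -- Chosen so that `2 * (2 * L * h) * (τ * h) = (θ / 2 * h) ^ 2`. The bounds on `k` and on `n` each
  -- account for half of the deficit `τ`.
  set τ : ℝ := θ ^ 2 / (16 * L) with hτ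
  have hτ0 : 0 < τ := by positivity
  set k : ℝ := min 1 (τ / (2 * L * m)) with hk
  have hk0 : 0 < k := lt_min one_pos (by positivity)
  have hk1 : k ≤ 1 := min_le_left _ _
  have hkτ : m * (k * L) ≤ τ / 2 := by
    have : k ≤ τ / (2 * L * m) := min_le_right _ _
    rw [le_div_iff₀ (by positivity)] at this
    linarith
  obtain ⟨n₁, hn₁⟩ := exists_nat_ge (8 * L * m / τ)
  refine ⟨k, hk0, G, hG's, n₁ + 1, fun n hn p h φ hh h0 h0' h1 h1' hφ A hA hshort => ?_⟩
  have hn0 : 0 < n := by omega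
  have hnr : (0 : ℝ) < n := by exact_mod_cast hn0
  have hnτ : m * (4 * L) ≤ n * (τ / 2) := by
    have h2 : (n₁ : ℝ) ≤ n := by exact_mod_cast (by omega : n₁ ≤ n)
    have h3 := hn₁.trans h2
    rw [div_le_iff₀ hτ0] at h3
    linarith
  have hmem : ∀ {i : ℕ} {z : Plane}, i ≤ n → z ∈ unitSquare → cellPoint p h i z ∈ unitSquare :=
    fun hi hz => cellPoint_mem_unitSquare hh.le h0 h0' h1 h1' hi hz
  have hend : cellPoint p h (n + 1) 0 = cellPoint p h n horizontal := by
    rw [← cellPoint_add_horizontal, zero_add]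
  have hmemE : cellPoint p h (n + 1) 0 ∈ unitSquare :=
    hend ▸ hmem le_rfl horizontal_mem_unitSquare
  have hs0 : 0 < (n + 1) * h := by positivity
  have hdE : dist (cellPoint p h (n + 1) 0) (cellPoint p h 0 0) = (n + 1) * h := by
    simp [cellPoint, norm_smul, abs_of_pos hh]
    rw [abs_of_pos (by positivity)]
    ring
  have hbi := hφ _ hmemE _ (hmem (Nat.zero_le n) zero_mem_unitSquare)
  rw [hdE, hA] at hbi
  have hA0 : 0 < A := (by positivity : 0 < 1 / L).trans_le (le_of_mul_le_mul_right hbi.1 hs0)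
  have hAL : A ≤ L := le_of_mul_le_mul_right hbi.2 hs0
  set D := φ (cellPoint p h (n + 1) 0) - φ (cellPoint p h 0 0) with hD
  have hDn : ‖D‖ = A * ((n + 1) * h) := by rw [← hA, dist_eq_norm]
  have hD0 : 0 < ‖D‖ := by rw [hDn]; positivity
  set u : Plane := ‖D‖⁻¹ • D with hu
  have hu1 : ‖u‖ = 1 := by
    rw [hu, norm_smul, norm_inv, norm_norm, inv_mul_cancel₀ hD0.ne']
  have hDu : inner ℝ D u = A * ((n + 1) * h) := by
    rw [hu, inner_smul_right, real_inner_self_eq_norm_sq, ← hDn]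
    field_simp
  set B := (1 + k) * A * h with hB
  have hB2 : B ≤ 2 * L * h := by
    rw [hB]
    have : (1 + k) * A ≤ 2 * L := mul_le_mul (by linarith) hAL hA0.le (by norm_num)
    exact mul_le_mul_of_nonneg_right this hh.le
  let W : ℕ → Plane → Plane := fun i g => φ (cellPoint p h (i + 1) g) - φ (cellPoint p h i g)
  have hW : ∀ i < n, ∀ g ∈ G, ‖W i g‖ ≤ B := fun i hi g hg => by
    rw [← dist_eq_norm]
    exact hshort i hi g hg
  -- The deficits `B - inner ℝ (W i g) u` are nonnegative and their sum telescopes. The total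
  -- displacement of `g` along the row differs from `D` by at most `2 * L * h` at each end, hence
  -- the term `4 * L / n`.
  obtain ⟨i, hi, hsmall⟩ := exists_forall_le_of_sum_sum_le hn0 (G := G)
    (d := fun i g => B - inner ℝ (W i g) u) (c := (k * L + 4 * L / n) * h) (fun i hi g hg => by
      have h2 := real_inner_le_norm (W i g) u
      rw [hu1, mul_one] at h2
      linarith [hW i hi g hg]) (fun g hg => by
      rw [Finset.sum_sub_distrib, ← sum_inner, Finset.sum_range_sub
        (fun i => φ (cellPoint p h i g))]
      have hgs : g ∈ unitSquare := hG's hg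
      have e1 : ‖φ (cellPoint p h (n + 1) 0) - φ (cellPoint p h n g)‖ ≤ L * (h * 2) := by
        rw [hend, ← dist_eq_norm]
        refine (hφ _ (hmem le_rfl horizontal_mem_unitSquare) _ (hmem le_rfl hgs)).2.trans ?_
        rw [dist_cellPoint hh.le]
        have := dist_le_two_of_mem_unitSquare horizontal_mem_unitSquare hgs
        gcongr
      have e2 : ‖φ (cellPoint p h 0 g) - φ (cellPoint p h 0 0)‖ ≤ L * (h * 2) := by
        rw [← dist_eq_norm]
        refine (hφ _ (hmem n.zero_le hgs) _ (hmem n.zero_le zero_mem_unitSquare)).2.trans ?_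
        rw [dist_cellPoint hh.le]
        have := dist_le_two_of_mem_unitSquare hgs zero_mem_unitSquare
        gcongr
      have e3 : φ (cellPoint p h n g) - φ (cellPoint p h 0 g) =
          D - (φ (cellPoint p h (n + 1) 0) - φ (cellPoint p h n g)) -
            (φ (cellPoint p h 0 g) - φ (cellPoint p h 0 0)) := by
        rw [hD]
        abel
      have e4 := real_inner_le_norm (φ (cellPoint p h (n + 1) 0) - φ (cellPoint p h n g)) u
      have e5 := real_inner_le_norm (φ (cellPoint p h 0 g) - φ (cellPoint p h 0 0)) u
      rw [hu1, mul_one] at e4 e5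
      rw [e3, inner_sub_left, inner_sub_left, hDu, Finset.sum_const, Finset.card_range,
        nsmul_eq_mul, hB]
      have e6 : (n : ℝ) * ((k * L + 4 * L / n) * h) = n * k * L * h + 4 * L * h := by
        field_simp
      have e7 : n * k * A * h ≤ n * k * L * h := by gcongr
      have e8 : 0 < A * h := by positivity
      rw [e6]
      linarith)
  refine ⟨i, hi, B • u, fun z hz => ?_⟩
  obtain ⟨g, hg, hgz⟩ := Set.mem_iUnion₂.mp (hcov hz)
  have hgG : g ∈ G := hg
  have hgs : g ∈ unitSquare := hG's hgG
  have hd : B - inner ℝ (W i g) u ≤ τ * h := by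
    refine (hsmall g hgG).trans ?_
    rw [← mul_assoc]
    refine mul_le_mul_of_nonneg_right ?_ hh.le
    have h2 : (G.card : ℝ) * (k * L + 4 * L / n) ≤ m * (k * L + 4 * L / n) := by
      have : (G.card : ℝ) ≤ m := by rw [hm]; linarith
      gcongr
    have h3 : m * (4 * L / n) ≤ τ / 2 := by
      rw [← mul_div_assoc, div_le_iff₀ hnr]
      linarith
    linarith
  have hclose : ‖W i g - B • u‖ ≤ θ / 2 * h := by
    have h2 := norm_sub_smul_sq_le hu1 (hW i hi g hgG) hd
    have h3 : 2 * B * (τ * h) ≤ (θ / 2 * h) ^ 2 := by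
      have h4 : B * (τ * h) ≤ 2 * L * h * (τ * h) :=
        mul_le_mul_of_nonneg_right hB2 (by positivity)
      have h5 : 2 * L * h * (τ * h) * 2 = (θ / 2 * h) ^ 2 := by
        rw [hτ]
        field_simp
        ring
      linarith
    exact le_of_sq_le_sq (h2.trans h3) (by positivity)
  have hLd : L * (h * dist z g) ≤ θ / 4 * h := by
    have h2 : dist z g < θ / (4 * L) := hgz
    rw [lt_div_iff₀ (by positivity)] at h2
    nlinarith
  have f1 : ‖φ (cellPoint p h (i + 1) z) - φ (cellPoint p h (i + 1) g)‖ ≤ θ / 4 * h := by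
    rw [← dist_eq_norm]
    refine (hφ _ (hmem hi hz) _ (hmem hi hgs)).2.trans ?_
    rwa [dist_cellPoint hh.le]
  have f2 : ‖φ (cellPoint p h i z) - φ (cellPoint p h i g)‖ ≤ θ / 4 * h := by
    rw [← dist_eq_norm]
    refine (hφ _ (hmem hi.le hz) _ (hmem hi.le hgs)).2.trans ?_
    rwa [dist_cellPoint hh.le]
  have f3 : φ (cellPoint p h (i + 1) z) - φ (cellPoint p h i z) - B • u =
      (φ (cellPoint p h (i + 1) z) - φ (cellPoint p h (i + 1) g)) -
      (φ (cellPoint p h i z) - φ (cellPoint p h i g)) + (W i g - B • u) := by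
    simp only [W]
    abel
  rw [f3]
  refine (norm_add_le _ _).trans ?_
  have := norm_sub_le (φ (cellPoint p h (i + 1) z) - φ (cellPoint p h (i + 1) g))
    (φ (cellPoint p h i z) - φ (cellPoint p h i g))
  linarith

/-! ### Areas of images of translated discs. -/

theorem volume_real_closedBall (a : Plane) {r : ℝ} (hr : 0 ≤ r) :
    volume.real (Metric.closedBall a r) = r ^ 2 * volume.real (Metric.ball (0 : Plane) 1) := by
  rw [Measure.addHaar_real_closedBall _ _ hr, finrank_euclideanSpace, Fintype.card_fin]

theorem volume_real_annulus (a : Plane) {r s : ℝ} (hs : 0 ≤ s) (hsr : s ≤ r) :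
    volume.real (Metric.closedBall a r \ Metric.ball a s) =
      (r ^ 2 - s ^ 2) * volume.real (Metric.ball (0 : Plane) 1) := by
  rw [measureReal_sdiff (Metric.ball_subset_closedBall.trans
      (Metric.closedBall_subset_closedBall hsr)) measurableSet_ball
      measure_closedBall_lt_top.ne,
    ← Measure.addHaar_real_closedBall_eq_addHaar_real_ball, volume_real_closedBall a hs,
    volume_real_closedBall a (hs.trans hsr), sub_mul]

theorem volume_real_image_add_right (v : Plane) (S : Set Plane) :
    volume.real ((fun y => y + v) '' S) = volume.real S := by
  rw [Set.image_add_right, Measure.real, measure_preimage_add_right, Measure.real]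

/-- If a bi-Lipschitz map almost commutes with the translation of one disc to another, then the
volumes of the images differ at most by the volume of the image of a thin annulus. -/
theorem volume_real_image_closedBall_le {L r θ : ℝ} {a v w : Plane} {φ : Plane → Plane}
    (hL : 0 < L) (hr : 0 < r) (hθ : 0 ≤ θ) (hφ : IsBiLipschitzWithOn L φ unitSquare)
    (h1 : Metric.closedBall a r ⊆ unitSquare) (h2 : Metric.closedBall (a + w) r ⊆ unitSquare)
    (h : ∀ x ∈ Metric.closedBall a r, ‖φ (x + w) - φ x - v‖ ≤ θ) :
    volume.real (φ '' Metric.closedBall a r) ≤ volume.real (φ '' Metric.closedBall (a + w) r) +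
      volume.real (φ '' (Metric.closedBall a r \ Metric.ball a (r - L * θ))) := by
  have hw : (fun x => x + w) '' Metric.closedBall a r = Metric.closedBall (a + w) r := by
    simp
  have hwm : Set.MapsTo (fun x => x + w) (Metric.closedBall a r) unitSquare := fun x hx =>
    h2 (hw ▸ ⟨x, hx, rfl⟩)
  have key := image_closedBall_subset_of_dist_le (a := a) (f := fun x => φ x + v)
    (g := fun x => φ (x + w)) hL hr hθ (fun x hx y hy => by
      simpa only [dist_add_right] using hφ x (h1 hx) y (h1 hy))
    (hφ.lipschitzOnWith.continuousOn.comp (by fun_prop) hwm)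
    (fun x hx => by rw [dist_eq_norm, ← sub_sub]; exact h x hx)
  have hf : ∀ S : Set Plane, (fun x => φ x + v) '' S = (fun y => y + v) '' (φ '' S) := fun S =>
    (Set.image_image (fun y => y + v) φ S).symm
  have hg : (fun x => φ (x + w)) '' Metric.closedBall a r =
      φ '' Metric.closedBall (a + w) r := by
    rw [← hw, Set.image_image]
  rw [hf, hf, hg] at key
  have hfin : ∀ {S : Set Plane}, S ⊆ unitSquare → volume (φ '' S) ≠ ⊤ := fun hS =>
    hφ.volume_image_ne_top hS
  have hA : Metric.closedBall a r \ Metric.ball a (r - L * θ) ⊆ unitSquare :=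
    Set.sdiff_subset.trans h1
  have hfin' : volume ((fun y => y + v) ''
      (φ '' (Metric.closedBall a r \ Metric.ball a (r - L * θ)))) ≠ ⊤ := by
    rw [Set.image_add_right, measure_preimage_add_right]
    exact hfin hA
  have := (measureReal_mono key (measure_union_ne_top (hfin h2) hfin')).trans
    (measureReal_union_le _ _)
  rwa [volume_real_image_add_right, volume_real_image_add_right] at this

/-- Each of the three image areas in `volume_real_image_closedBall_le` is an integral of `ρ` up to
`δ`, and the annulus has area at most `2 * r * (L * θ)` times that of the unit disc. -/
theorem density_gap_le {L r θ δ M m₁ m₂ : ℝ} {a v w : Plane} {φ : Plane → Plane} {ρ : Plane → ℝ}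
    (hL : 0 < L) (hr : 0 < r) (hθ : 0 ≤ θ) (hθr : L * θ ≤ r)
    (hφ : IsBiLipschitzWithOn L φ unitSquare)
    (h1 : Metric.closedBall a r ⊆ unitSquare) (h2 : Metric.closedBall (a + w) r ⊆ unitSquare)
    (h : ∀ x ∈ Metric.closedBall a r, ‖φ (x + w) - φ x - v‖ ≤ θ)
    (hρ : Continuous ρ) (hreal : RealizesDensity δ ρ φ) (hM : 0 ≤ M)
    (hρM : ∀ x ∈ unitSquare, ρ x ≤ M) (hm₁ : ∀ x ∈ Metric.closedBall a r, m₁ ≤ ρ x)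
    (hm₂ : ∀ x ∈ Metric.closedBall (a + w) r, ρ x ≤ m₂) :
    (m₁ - m₂) * (r ^ 2 * volume.real (Metric.ball (0 : Plane) 1)) ≤
      M * (2 * r * (L * θ) * volume.real (Metric.ball (0 : Plane) 1)) + 3 * δ := by
  set κ := volume.real (Metric.ball (0 : Plane) 1)
  have hLθ : 0 ≤ L * θ := by positivity
  set A := Metric.closedBall a r \ Metric.ball a (r - L * θ) with hA
  have hAs : A ⊆ unitSquare := Set.sdiff_subset.trans h1
  have hAm : MeasurableSet A := measurableSet_closedBall.diff measurableSet_ball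
  have hvol := volume_real_image_closedBall_le hL hr hθ hφ h1 h2 h
  have r1 := abs_le.mp (hreal _ h1 measurableSet_closedBall)
  have r2 := abs_le.mp (hreal _ h2 measurableSet_closedBall)
  have r3 := abs_le.mp (hreal _ hAs hAm)
  have upper : ∀ {E : Set Plane} {c : ℝ}, E ⊆ unitSquare → MeasurableSet E →
      (∀ x ∈ E, ρ x ≤ c) → ∫ x in E, ρ x ≤ c * volume.real E := by
    intro E c hE hEm hc
    have hfin : volume E < ⊤ := (measure_mono hE).trans_lt volume_unitSquare_lt_top
    have := setIntegral_mono_on (integrableOn_of_continuous_of_subset_unitSquare hρ hE)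
      (integrableOn_const hfin.ne) hEm hc
    rwa [setIntegral_const, smul_eq_mul, mul_comm] at this
  have i1 : m₁ * (r ^ 2 * κ) ≤ ∫ x in Metric.closedBall a r, ρ x := by
    rw [← volume_real_closedBall a hr.le]
    exact setIntegral_ge_of_const_le_real measurableSet_closedBall measure_closedBall_lt_top.ne
      hm₁ (integrableOn_of_continuous_of_subset_unitSquare hρ h1)
  have i2 : ∫ x in Metric.closedBall (a + w) r, ρ x ≤ m₂ * (r ^ 2 * κ) := by
    rw [← volume_real_closedBall (a + w) hr.le]
    exact upper h2 measurableSet_closedBall hm₂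
  have i3 : ∫ x in A, ρ x ≤ M * (2 * r * (L * θ) * κ) := by
    refine (upper hAs hAm fun x hx => hρM x (hAs hx)).trans ?_
    rw [hA, volume_real_annulus a (by linarith) (by linarith)]
    refine mul_le_mul_of_nonneg_left (mul_le_mul_of_nonneg_right ?_ measureReal_nonneg) hM
    nlinarith [sq_nonneg (L * θ)]
  linarith

/-! ### Oscillating densities and the stretching they force. -/

/-- `ρ` with an oscillation `ρ₀ ± ε` of wavelength `2 * h` inserted in a horizontal strip. -/
noncomputable def insertOscillation (ρ ρ₀ : Plane → ℝ) (ε h : ℝ) (p x : Plane) : ℝ :=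
  ρ x + max 0 (min 1 (2 - |x 1 - p 1| / h)) *
    (ρ₀ x + ε * Real.sin (Real.pi * ((x 0 - p 0) / h)) - ρ x)

section insertOscillation

variable {ρ ρ₀ : Plane → ℝ} {ε h : ℝ} {p x : Plane}

theorem continuous_insertOscillation (hρ : Continuous ρ) (hρ₀ : Continuous ρ₀) :
    Continuous (insertOscillation ρ ρ₀ ε h p) := by
  unfold insertOscillation
  fun_prop

/-- The new value is a convex combination of `ρ` and `ρ₀ + ε * sin`, both within `ε` of `ρ₀`.
Repeated insertions therefore never leave the `ε`-tube. -/
theorem abs_insertOscillation_sub_le (hε : 0 ≤ ε) (hx : |ρ x - ρ₀ x| ≤ ε) :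
    |insertOscillation ρ ρ₀ ε h p x - ρ₀ x| ≤ ε := by
  unfold insertOscillation
  set c := max 0 (min 1 (2 - |x 1 - p 1| / h))
  have c0 : 0 ≤ c := le_max_left _ _
  have c1 : c ≤ 1 := max_le zero_le_one (min_le_left _ _)
  have s1 := mul_le_mul_of_nonneg_left (Real.sin_le_one (Real.pi * ((x 0 - p 0) / h))) hε
  have s2 := mul_le_mul_of_nonneg_left (Real.neg_one_le_sin (Real.pi * ((x 0 - p 0) / h))) hε
  set t := ε * Real.sin (Real.pi * ((x 0 - p 0) / h))
  rw [abs_le] at hx ⊢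
  constructor <;> nlinarith

theorem abs_sub_insertOscillation_le (hε : 0 ≤ ε) (hx : |ρ x - ρ₀ x| ≤ ε) :
    |insertOscillation ρ ρ₀ ε h p x - ρ x| ≤ 2 * ε := by
  have h1 := abs_insertOscillation_sub_le (h := h) (p := p) hε hx
  rw [abs_le] at h1 hx ⊢
  constructor <;> linarith

theorem insertOscillation_eq_self (hh : 0 < h) (hx : 2 * h < |x 1 - p 1|) :
    insertOscillation ρ ρ₀ ε h p x = ρ x := by
  have : 2 < |x 1 - p 1| / h := (lt_div_iff₀ hh).mpr hx
  rw [insertOscillation, max_eq_left ((min_le_right _ _).trans (by linarith)), zero_mul, add_zero]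

theorem insertOscillation_eq (hh : 0 < h) (hx : |x 1 - p 1| ≤ h) :
    insertOscillation ρ ρ₀ ε h p x =
      ρ₀ x + ε * Real.sin (Real.pi * ((x 0 - p 0) / h)) := by
  have : |x 1 - p 1| / h ≤ 1 := (div_le_one hh).mpr hx
  rw [insertOscillation, min_eq_left (by linarith), max_eq_right zero_le_one]
  ring

end insertOscillation

/-- The center of the unit square. -/
noncomputable def squareCenter : Plane := !₂[1 / 2, 1 / 2]

theorem mem_Icc_of_mem_closedBall_squareCenter {z : Plane}
    (hz : z ∈ Metric.closedBall squareCenter (1 / 4)) (i : Fin 2) :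
    z i ∈ Set.Icc (1 / 4 : ℝ) (3 / 4) := by
  have h1 := (PiLp.norm_apply_le (z - squareCenter) i).trans (mem_closedBall_iff_norm.mp hz)
  have h2 : squareCenter i = 1 / 2 := by fin_cases i <;> simp [squareCenter]
  rw [PiLp.sub_apply, h2, Real.norm_eq_abs, abs_le] at h1
  constructor <;> linarith

theorem closedBall_squareCenter_subset :
    Metric.closedBall squareCenter (1 / 4) ⊆ unitSquare := fun z hz i => by
  have := mem_Icc_of_mem_closedBall_squareCenter hz i
  constructor <;> linarith [this.1, this.2]

theorem exists_eq_cellPoint {p x : Plane} {h : ℝ} {i : ℕ} (hh : 0 < h)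
    (hx : x ∈ Metric.closedBall (cellPoint p h i squareCenter) (h / 4)) :
    ∃ z ∈ Metric.closedBall squareCenter (1 / 4), cellPoint p h i z = x := by
  obtain ⟨z, rfl⟩ : ∃ z, cellPoint p h i z = x :=
    ⟨h⁻¹ • (x - p) - (i : ℝ) • horizontal, by simp [cellPoint, smul_smul, hh.ne']⟩
  refine ⟨z, ?_, rfl⟩
  rw [Metric.mem_closedBall, dist_cellPoint hh.le] at hx
  rw [Metric.mem_closedBall]
  nlinarith

theorem half_le_sin_pi_mul {t : ℝ} (ht : t ∈ Set.Icc (1 / 4 : ℝ) (3 / 4)) :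
    1 / 2 ≤ Real.sin (Real.pi * t) := by
  have key : ∀ t : ℝ, 1 / 4 ≤ t → t ≤ 1 / 2 → 1 / 2 ≤ Real.sin (Real.pi * t) := fun t h1 h2 => by
    have hπ := Real.pi_pos
    have := Real.mul_le_sin (x := Real.pi * t) (by positivity) (by nlinarith)
    have e : 2 / Real.pi * (Real.pi * t) = 2 * t := by field_simp
    linarith
  rcases le_total t (1 / 2) with h | h
  · exact key t ht.1 h
  · rw [show Real.pi * t = Real.pi - Real.pi * (1 - t) by ring, Real.sin_pi_sub]
    exact key _ (by linarith [ht.2]) (by linarith)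

theorem insertOscillation_cellPoint {ρ ρ₀ : Plane → ℝ} {ε h : ℝ} {p z : Plane} (hh : 0 < h)
    (i : ℕ) (hz : z ∈ unitSquare) :
    insertOscillation ρ ρ₀ ε h p (cellPoint p h i z) =
      ρ₀ (cellPoint p h i z) + ε * ((-1) ^ i * Real.sin (Real.pi * z 0)) := by
  rw [insertOscillation_eq hh, cellPoint_apply_zero, add_sub_cancel_left,
    mul_div_cancel_left₀ _ hh.ne', ← Real.sin_add_nat_mul_pi]
  · ring_nf
  · rw [cellPoint_apply_one, add_sub_cancel_left, abs_mul, abs_of_pos hh, abs_of_nonneg (hz 1).1]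
    exact mul_le_of_le_one_right hh.le (hz 1).2

/-- A pair `(p, s)` describing a horizontal segment of length `s` with left end `p` in the unit
square, below its upper side. -/
def IsSegment (σ : Plane × ℝ) : Prop :=
  0 < σ.2 ∧ 0 ≤ σ.1 0 ∧ σ.1 0 + σ.2 ≤ 1 ∧ 0 ≤ σ.1 1 ∧ σ.1 1 < 1

/-- `φ` stretches the segment `σ` at least by the factor `a`. -/
def Stretches (φ : Plane → Plane) (σ : Plane × ℝ) (a : ℝ) : Prop :=
  a * σ.2 ≤ dist (φ (σ.1 + σ.2 • horizontal)) (φ σ.1)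

/-- On the central discs the sine is at least `1 / 2` in absolute value, with sign alternating
between cells. The variation of `ρ₀` costs `ε / 8`, which leaves `3 / 8 * ε` on either side of the
value of `ρ₀` at a cell center. -/
theorem exists_density_gap {ρ ρ₀ : Plane → ℝ} {ε h η : ℝ} {p : Plane} {n i : ℕ} (hε : 0 < ε)
    (hh : 0 < h) (h0 : 0 ≤ p 0) (h0' : p 0 + (n + 1) * h ≤ 1) (h1 : 0 ≤ p 1) (h1' : p 1 + h ≤ 1)
    (hi : i < n) (hη : 2 * h < η)
    (hcont : ∀ x ∈ unitSquare, ∀ y ∈ unitSquare, dist x y < η → |ρ₀ x - ρ₀ y| ≤ ε / 8) :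
    ∃ m : ℝ, ∀ j, j = i ∨ j = i + 1 →
      ∀ x ∈ Metric.closedBall (cellPoint p h j squareCenter) (h / 4),
        (Even j → m + 3 / 8 * ε ≤ insertOscillation ρ ρ₀ ε h p x) ∧
        (¬ Even j → insertOscillation ρ ρ₀ ε h p x ≤ m - 3 / 8 * ε) := by
  have hmem : ∀ {j : ℕ} {z : Plane}, j ≤ n → z ∈ unitSquare → cellPoint p h j z ∈ unitSquare :=
    fun hi hz => cellPoint_mem_unitSquare hh.le h0 h0' h1 h1' hi hz
  have hc : squareCenter ∈ unitSquare :=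
    closedBall_squareCenter_subset (Metric.mem_closedBall_self (by norm_num))
  refine ⟨ρ₀ (cellPoint p h i squareCenter), fun j hj x hx => ?_⟩
  obtain ⟨z, hz, rfl⟩ := exists_eq_cellPoint hh hx
  have hzs := closedBall_squareCenter_subset hz
  have hjn : j ≤ n := by omega
  have hstep : dist (cellPoint p h j squareCenter) (cellPoint p h i squareCenter) ≤ h := by
    rcases hj with rfl | rfl
    · simpa using hh.le
    · rw [← cellPoint_add_horizontal, dist_cellPoint hh.le]
      simp
  have hd : dist (cellPoint p h j z) (cellPoint p h i squareCenter) < η := by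
    have := dist_triangle (cellPoint p h j z) (cellPoint p h j squareCenter)
      (cellPoint p h i squareCenter)
    have h2 := Metric.mem_closedBall.mp hx
    linarith
  have hosc := abs_le.mp (hcont _ (hmem hjn hzs) _ (hmem hi.le hc) hd)
  have hsin := mul_le_mul_of_nonneg_left
    (half_le_sin_pi_mul (mem_Icc_of_mem_closedBall_squareCenter hz 0)) hε.le
  rw [insertOscillation_cellPoint hh j hzs]
  constructor
  · intro he
    rw [he.neg_one_pow, one_mul]
    linarith [hosc.1]
  · intro he
    rw [(Nat.not_even_iff_odd.mp he).neg_one_pow]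
    linarith [hosc.2]

/-- An oscillation inserted along a segment forces any map realizing the density to stretch some
smaller segment by a definite factor more. -/
theorem exists_insertOscillation_stretches {L ε M : ℝ} (hL : 1 ≤ L) (hε : 0 < ε) (hεM : ε ≤ M)
    {ρ₀ : Plane → ℝ} (hρ₀ : Continuous ρ₀) (hM : ∀ x ∈ unitSquare, ρ₀ x + ε ≤ M) :
    ∃ k > 0, ∀ σ, IsSegment σ → ∀ ρ : Plane → ℝ, Continuous ρ →
      (∀ x ∈ unitSquare, |ρ x - ρ₀ x| ≤ ε) → ∀ δ > 0,
      ∃ ρ' : Plane → ℝ, Continuous ρ' ∧ (∀ x ∈ unitSquare, |ρ' x - ρ₀ x| ≤ ε) ∧ ∃ δ' > 0,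
        (∀ φ, RealizesDensity δ' ρ' φ → RealizesDensity δ ρ φ) ∧
        ∃ F : Set (Plane × ℝ), F.Finite ∧ (∀ τ ∈ F, IsSegment τ) ∧
          ∀ φ, IsBiLipschitzWithOn L φ unitSquare → RealizesDensity δ' ρ' φ →
            ∀ a, Stretches φ σ a → ∃ τ ∈ F, Stretches φ τ ((1 + k) * a) := by
  have hM0 : 0 < M := hε.trans_le hεM
  have hL0 : 0 < L := zero_lt_one.trans_le hL
  -- In units of `ε * κ * h ^ 2`, this `θ` makes the annulus term `1 / 64`. With the error `3 * δ'`
  -- of at most `3 / 128` it stays below the density gap `3 / 64`.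
  obtain ⟨k, hk, G, hG, n₀, hcell⟩ := exists_cell_almost_translated (L := L)
    (θ := ε / (32 * M * L)) hL (by positivity)
  refine ⟨k, hk, ?_⟩
  rintro ⟨p, s⟩ ⟨hs, h0, h0', h1, h1'⟩ ρ hρ hρε δ hδ
  simp only at hs h0 h0' h1 h1'
  obtain ⟨η, hη, hcont⟩ := Metric.uniformContinuousOn_iff.mp
    (isCompact_unitSquare.uniformContinuousOn_of_continuous hρ₀.continuousOn) (ε / 8)
    (by positivity)
  -- The three bounds on the cell side keep the row below the upper side of the square, make `ρ₀`
  -- nearly constant on adjacent cells, and bound the effect `2 * ε * (4 * h)` of the strip by `δ /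
  -- 2`.
  obtain ⟨n, hn₀, hn⟩ : ∃ n ≥ n₀, s / (n + 1) < min (1 - p 1) (min (η / 2) (δ / (16 * ε))) := by
    have hpos : 0 < min (1 - p 1) (min (η / 2) (δ / (16 * ε))) :=
      lt_min (by linarith) (lt_min (by positivity) (by positivity))
    obtain ⟨n, hn⟩ := exists_nat_gt (s / min (1 - p 1) (min (η / 2) (δ / (16 * ε))))
    refine ⟨max n n₀, le_max_right _ _, ?_⟩
    rw [div_lt_iff₀ hpos] at hn
    rw [div_lt_iff₀ (by positivity), mul_comm]
    have : (n : ℝ) ≤ (max n n₀ : ℕ) := by exact_mod_cast le_max_left _ _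
    nlinarith
  set h := s / (n + 1) with hh_def
  have hh : 0 < h := by positivity
  have hsn : (n + 1) * h = s := by rw [hh_def]; field_simp
  rw [lt_min_iff, lt_min_iff] at hn
  obtain ⟨hhp, hhη, hhδ⟩ := hn
  set κ := volume.real (Metric.ball (0 : Plane) 1) with hκ
  have hκ0 : 0 < κ := ENNReal.toReal_pos (Metric.measure_ball_pos _ _ one_pos).ne'
    measure_ball_lt_top.ne
  set δ' := min (δ / 2) (ε * κ * h ^ 2 / 128) with hδ'
  have hδ'0 : 0 < δ' := lt_min (by positivity) (by positivity)
  have hρ' := continuous_insertOscillation (ε := ε) (h := h) (p := p) hρ hρ₀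
  have hp0n : p 0 + (n + 1) * h ≤ 1 := by rw [hsn]; exact h0'
  have hp1h : p 1 + h ≤ 1 := by linarith
  have hmem : ∀ {j : ℕ} {z : Plane}, j ≤ n → z ∈ unitSquare → cellPoint p h j z ∈ unitSquare :=
    fun hi hz => cellPoint_mem_unitSquare hh.le h0 hp0n h1 hp1h hi hz
  refine ⟨insertOscillation ρ ρ₀ ε h p, hρ',
    fun x hx => abs_insertOscillation_sub_le hε.le (hρε x hx), δ', hδ'0, ?_, ?_⟩
  · intro φ hφ E hE hEm
    refine (hφ.of_abs_sub_le hρ' hρ (S := {x | |x 1 - p 1| ≤ 2 * h}) (c := 2 * ε) (by positivity)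
      (fun x hx => abs_sub_insertOscillation_le hε.le (hρε x hx.1))
      (fun x hx => insertOscillation_eq_self hh (not_le.mp hx.2)) E hE hEm).trans ?_
    have hv := volume_real_strip_le (c := p 1) hh.le
    have hd : δ' ≤ δ / 2 := min_le_left _ _
    rw [lt_div_iff₀ (by positivity)] at hhδ
    nlinarith [mul_le_mul_of_nonneg_left hv hε.le]
  refine ⟨(fun q : ℕ × Plane => (cellPoint p h q.1 q.2, h)) '' ↑(Finset.range n ×ˢ G),
    (Finset.finite_toSet _).image _, ?_, ?_⟩
  · rintro _ ⟨⟨i, g⟩, hig, rfl⟩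
    simp only [Finset.mem_coe, Finset.mem_product, Finset.mem_range] at hig
    have hgs := hG hig.2
    have hi : (i : ℝ) + 1 ≤ n := by exact_mod_cast hig.1
    have hc := hmem hig.1.le hgs
    refine ⟨hh, (hc 0).1, ?_, (hc 1).1, ?_⟩
    · simp only [cellPoint_apply_zero]
      have := mul_le_mul_of_nonneg_left (add_le_add hi (hgs 0).2) hh.le
      linarith
    · simp only [cellPoint_apply_one]
      have := mul_le_mul_of_nonneg_left (hgs 1).2 hh.le
      linarith
  intro φ hφ hreal a ha
  by_contra hno
  push Not at hno
  have hstart : cellPoint p h 0 0 = p := by simp [cellPoint]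
  have hend : cellPoint p h (n + 1) 0 = p + s • horizontal := by
    rw [← hsn, cellPoint]
    push_cast
    module
  -- The cell argument needs the exact stretch `A` of the segment. Since `a ≤ A`, failure to reach
  -- `(1 + k) * a` bounds the short segments by `(1 + k) * A`.
  set A := dist (φ (p + s • horizontal)) (φ p) / s with hA
  have hAs : dist (φ (p + s • horizontal)) (φ p) = A * s := by rw [hA]; field_simp
  have haA : a ≤ A := by rw [hA, le_div_iff₀ hs]; exact ha
  obtain ⟨i, hi, v, hv⟩ := hcell n hn₀ p h φ hh h0 hp0n h1 hp1h hφ A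
    (by rw [hstart, hend, hsn, hAs]) fun i hi g hg => by
      have h2 := hno _ ⟨(i, g), by simp [hi, hg], rfl⟩
      rw [Stretches, not_le] at h2
      have h3 : cellPoint p h i g + h • horizontal = cellPoint p h (i + 1) g := by
        rw [← cellPoint_add_horizontal, cellPoint, cellPoint]
        module
      simp only [h3] at h2
      refine h2.le.trans ?_
      gcongr
  obtain ⟨m, hm⟩ := exists_density_gap (ρ := ρ) (η := η) hε hh h0 hp0n h1 hp1h hi
    (by linarith) fun x hx y hy hxy => by
      rw [← Real.dist_eq]
      exact (hcont x hx y hy hxy).le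
  have hball : ∀ {j : ℕ}, j ≤ n →
      Metric.closedBall (cellPoint p h j squareCenter) (h / 4) ⊆ unitSquare := fun hj x hx => by
    obtain ⟨z, hz, rfl⟩ := exists_eq_cellPoint hh hx
    exact hmem hj (closedBall_squareCenter_subset hz)
  have hshift : ∀ (j : ℕ) (z : Plane),
      cellPoint p h j z + h • horizontal = cellPoint p h (j + 1) z := fun j z => by
    rw [← cellPoint_add_horizontal, cellPoint, cellPoint]
    module
  have hshift' : ∀ (j : ℕ) (z : Plane),
      cellPoint p h (j + 1) z + -(h • horizontal) = cellPoint p h j z := fun j z => by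
    rw [← hshift, add_neg_cancel_right]
  have hb0 := hball hi.le
  have hb1 := hball hi
  have hθ0 : 0 ≤ ε / (32 * M * L) * h := by positivity
  have hLθ : L * (ε / (32 * M * L) * h) = ε / M * h / 32 := by field_simp
  have hεM1 : ε / M ≤ 1 := (div_le_one hM0).mpr hεM
  have hθr : L * (ε / (32 * M * L) * h) ≤ h / 4 := by
    rw [hLθ]
    nlinarith
  have hρM : ∀ x ∈ unitSquare, insertOscillation ρ ρ₀ ε h p x ≤ M := fun x hx => by
    have h2 := abs_le.mp (abs_insertOscillation_sub_le (h := h) (p := p) hε.le (hρε x hx))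
    linarith [hM x hx]
  have hgap : (m + 3 / 8 * ε - (m - 3 / 8 * ε)) * ((h / 4) ^ 2 * κ) ≤
      M * (2 * (h / 4) * (L * (ε / (32 * M * L) * h)) * κ) + 3 * δ' := by
    -- The comparison must start from the denser disc, which lies in the even cell. For odd `i` the
    -- translation is therefore read backwards.
    rcases Nat.even_or_odd i with he | ho
    · refine density_gap_le (a := cellPoint p h i squareCenter) (w := h • horizontal) (v := v)
        hL0 (by positivity) hθ0 hθr hφ hb0 (by rwa [hshift]) ?_ hρ' hreal hM0.le hρM
        (fun x hx => (hm i (Or.inl rfl) x hx).1 he) ?_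
      · intro x hx
        obtain ⟨z, hz, rfl⟩ := exists_eq_cellPoint hh hx
        rw [hshift]
        exact hv z (closedBall_squareCenter_subset hz)
      · rw [hshift]
        exact fun x hx => (hm (i + 1) (Or.inr rfl) x hx).2 (by simpa [Nat.even_add_one] using he)
    · have ho' := Nat.not_even_iff_odd.mpr ho
      refine density_gap_le (a := cellPoint p h (i + 1) squareCenter) (w := -(h • horizontal))
        (v := -v) hL0 (by positivity) hθ0 hθr hφ hb1 (by rwa [hshift']) ?_ hρ' hreal hM0.le hρM
        (fun x hx => (hm (i + 1) (Or.inr rfl) x hx).1 (by simpa [Nat.even_add_one] using ho')) ?_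
      · intro x hx
        obtain ⟨z, hz, rfl⟩ := exists_eq_cellPoint hh hx
        have e : φ (cellPoint p h i z) - φ (cellPoint p h (i + 1) z) - -v =
            -(φ (cellPoint p h (i + 1) z) - φ (cellPoint p h i z) - v) := by abel
        rw [hshift', e, norm_neg]
        exact hv z (closedBall_squareCenter_subset hz)
      · rw [hshift']
        exact fun x hx => (hm i (Or.inl rfl) x hx).2 ho'
  have hδκ : δ' ≤ ε * κ * h ^ 2 / 128 := min_le_right _ _
  have e1 : M * (2 * (h / 4) * (L * (ε / (32 * M * L) * h)) * κ) = ε * κ * h ^ 2 / 64 := by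
    field_simp
    ring
  have hpos : 0 < ε * κ * h ^ 2 := by positivity
  rw [e1] at hgap
  linarith

/-! ### Iteration of the stretching step. -/

/-- Oscillations are inserted for one segment after another. A map realizing the last density still
realizes the earlier ones within their tolerances, so every forced stretching persists. -/
theorem exists_density_stretches_of_finite {L ε k : ℝ} {ρ₀ : Plane → ℝ}
    (hstep : ∀ σ, IsSegment σ → ∀ ρ : Plane → ℝ, Continuous ρ →
      (∀ x ∈ unitSquare, |ρ x - ρ₀ x| ≤ ε) → ∀ δ > 0,
      ∃ ρ' : Plane → ℝ, Continuous ρ' ∧ (∀ x ∈ unitSquare, |ρ' x - ρ₀ x| ≤ ε) ∧ ∃ δ' > 0,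
        (∀ φ, RealizesDensity δ' ρ' φ → RealizesDensity δ ρ φ) ∧
        ∃ F : Set (Plane × ℝ), F.Finite ∧ (∀ τ ∈ F, IsSegment τ) ∧
          ∀ φ, IsBiLipschitzWithOn L φ unitSquare → RealizesDensity δ' ρ' φ →
            ∀ a, Stretches φ σ a → ∃ τ ∈ F, Stretches φ τ ((1 + k) * a))
    {S : Set (Plane × ℝ)} (hS : S.Finite) (hSs : ∀ σ ∈ S, IsSegment σ) {ρ : Plane → ℝ}
    (hρ : Continuous ρ) (hρε : ∀ x ∈ unitSquare, |ρ x - ρ₀ x| ≤ ε) {δ : ℝ} (hδ : 0 < δ) :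
    ∃ ρ' : Plane → ℝ, Continuous ρ' ∧ (∀ x ∈ unitSquare, |ρ' x - ρ₀ x| ≤ ε) ∧ ∃ δ' > 0,
      (∀ φ, RealizesDensity δ' ρ' φ → RealizesDensity δ ρ φ) ∧
      ∃ F : Set (Plane × ℝ), F.Finite ∧ (∀ τ ∈ F, IsSegment τ) ∧
        ∀ φ, IsBiLipschitzWithOn L φ unitSquare → RealizesDensity δ' ρ' φ →
          ∀ a, ∀ σ ∈ S, Stretches φ σ a → ∃ τ ∈ F, Stretches φ τ ((1 + k) * a) := by
  induction S, hS using Set.Finite.induction_on with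
  | empty => exact ⟨ρ, hρ, hρε, δ, hδ, fun _ h => h, ∅, Set.finite_empty, by simp, by simp⟩
  | @insert σ S _ _ ih =>
    obtain ⟨ρ₁, hρ₁, hρε₁, δ₁, hδ₁, himp₁, F₁, hF₁, hFs₁, hst₁⟩ :=
      ih fun τ hτ => hSs τ (Set.mem_insert_of_mem _ hτ)
    obtain ⟨ρ₂, hρ₂, hρε₂, δ₂, hδ₂, himp₂, F₂, hF₂, hFs₂, hst₂⟩ :=
      hstep σ (hSs σ (Set.mem_insert _ _)) ρ₁ hρ₁ hρε₁ δ₁ hδ₁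
    refine ⟨ρ₂, hρ₂, hρε₂, δ₂, hδ₂, fun φ h => himp₁ φ (himp₂ φ h), F₁ ∪ F₂, hF₁.union hF₂,
      fun τ hτ => hτ.elim (hFs₁ τ) (hFs₂ τ), ?_⟩
    rintro φ hφ hreal a τ (rfl | hτ) ha
    · obtain ⟨υ, hυ, h⟩ := hst₂ φ hφ hreal a ha
      exact ⟨υ, Or.inr hυ, h⟩
    · obtain ⟨υ, hυ, h⟩ := hst₁ φ hφ (himp₂ φ hreal) a τ hτ ha
      exact ⟨υ, Or.inl hυ, h⟩

theorem IsSegment.mem_unitSquare {σ : Plane × ℝ} (hσ : IsSegment σ) :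
    σ.1 ∈ unitSquare ∧ σ.1 + σ.2 • horizontal ∈ unitSquare := by
  obtain ⟨hs, h0, h0', h1, h1'⟩ := hσ
  simp only [unitSquare, Set.mem_ofPred_eq, Fin.forall_fin_two, Set.mem_Icc, PiLp.add_apply,
    PiLp.smul_apply, horizontal_apply_zero, horizontal_apply_one, smul_eq_mul, mul_one, mul_zero,
    add_zero]
  refine ⟨⟨⟨?_, ?_⟩, ?_, ?_⟩, ⟨?_, ?_⟩, ?_, ?_⟩ <;> linarith

theorem IsSegment.le_of_stretches {σ : Plane × ℝ} (hσ : IsSegment σ) {L a : ℝ}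
    {φ : Plane → Plane} (hφ : IsBiLipschitzWithOn L φ unitSquare) (ha : Stretches φ σ a) :
    a ≤ L := by
  have h := (hφ _ hσ.mem_unitSquare.2 _ hσ.mem_unitSquare.1).2
  rw [dist_self_add_left, norm_smul, norm_horizontal, mul_one, Real.norm_of_nonneg hσ.1.le] at h
  exact le_of_mul_le_mul_right (ha.trans h) hσ.1

/-- Every continuous density is uniformly close to one that no `L`-bi-Lipschitz map realizes, even
approximately. -/
theorem exists_density_forall_not_realizesDensity {L ε M : ℝ} (hL : 1 ≤ L) (hε : 0 < ε)
    (hεM : ε ≤ M) {ρ₀ : Plane → ℝ} (hρ₀ : Continuous ρ₀) (hM : ∀ x ∈ unitSquare, ρ₀ x + ε ≤ M) :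
    ∃ ρ : Plane → ℝ, Continuous ρ ∧ (∀ x ∈ unitSquare, |ρ x - ρ₀ x| ≤ ε) ∧ ∃ δ > 0,
      ∀ φ, IsBiLipschitzWithOn L φ unitSquare → ¬ RealizesDensity δ ρ φ := by
  have hL0 : 0 < L := zero_lt_one.trans_le hL
  obtain ⟨k, hk, hstep⟩ := exists_insertOscillation_stretches hL hε hεM hρ₀ hM
  have stage : ∀ t : ℕ, ∃ ρ : Plane → ℝ, Continuous ρ ∧
      (∀ x ∈ unitSquare, |ρ x - ρ₀ x| ≤ ε) ∧ ∃ δ > 0,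
      ∃ F : Set (Plane × ℝ), F.Finite ∧ (∀ τ ∈ F, IsSegment τ) ∧
        ∀ φ, IsBiLipschitzWithOn L φ unitSquare → RealizesDensity δ ρ φ →
          ∃ τ ∈ F, Stretches φ τ ((1 + k) ^ t * (1 / L)) := by
    intro t
    induction t with
    | zero =>
      have hseg : IsSegment ((0 : Plane), (1 : ℝ)) := by simp [IsSegment]
      refine ⟨ρ₀, hρ₀, by simp [hε.le], 1, one_pos, {((0 : Plane), (1 : ℝ))},
        Set.finite_singleton _, by simpa using hseg, fun φ hφ _ => ⟨_, rfl, ?_⟩⟩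
      have h := (hφ _ hseg.mem_unitSquare.2 _ hseg.mem_unitSquare.1).1
      rw [dist_self_add_left, norm_smul, norm_horizontal, mul_one, norm_one] at h
      simpa only [Stretches, pow_zero, one_mul] using h
    | succ t ih =>
      obtain ⟨ρ, hρ, hρε, δ, hδ, F, hF, hFs, hst⟩ := ih
      obtain ⟨ρ', hρ', hρε', δ', hδ', himp, F', hF', hFs', hst'⟩ :=
        exists_density_stretches_of_finite hstep hF hFs hρ hρε hδ
      refine ⟨ρ', hρ', hρε', δ', hδ', F', hF', hFs', fun φ hφ hreal => ?_⟩
      obtain ⟨τ, hτ, h⟩ := hst φ hφ (himp φ hreal)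
      obtain ⟨υ, hυ, h'⟩ := hst' φ hφ hreal _ τ hτ h
      exact ⟨υ, hυ, by rwa [pow_succ', mul_assoc]⟩
  -- The initial stretch is at least `1 / L`, so beating `L` needs growth by more than `L * L`.
  obtain ⟨t, ht⟩ := pow_unbounded_of_one_lt (L * L) (by linarith : 1 < 1 + k)
  obtain ⟨ρ, hρ, hρε, δ, hδ, F, -, hFs, hst⟩ := stage t
  refine ⟨ρ, hρ, hρε, δ, hδ, fun φ hφ hreal => ?_⟩
  obtain ⟨τ, hτ, h⟩ := hst φ hφ hreal
  have := (hFs τ hτ).le_of_stretches hφ h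
  rw [mul_one_div, div_le_iff₀ hL0] at this
  linarith

/-! ### Baire category argument. -/

/-- The nearest point retraction of the plane onto the unit square. -/
noncomputable def clampSquare (x : Plane) : unitSquare :=
  ⟨WithLp.toLp 2 fun i => (Set.projIcc (0 : ℝ) 1 zero_le_one (x i) : ℝ),
    fun i => (Set.projIcc (0 : ℝ) 1 zero_le_one (x i)).2⟩

theorem continuous_clampSquare : Continuous clampSquare := by
  refine Continuous.subtype_mk ((PiLp.continuous_toLp 2 _).comp (continuous_pi fun i => ?_)) _
  exact continuous_subtype_val.comp (continuous_projIcc.comp (by fun_prop))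

theorem clampSquare_coe (x : unitSquare) : clampSquare x = x := by
  ext i
  simp [clampSquare, Set.projIcc_of_mem _ (x.2 i)]

/-- The positive densities that are the unsigned Jacobian of an `L`-bi-Lipschitz map. -/
def absJacobianDensities (L : ℝ) : Set PositiveDensity :=
  {ρ | ∃ φ : Plane → Plane, IsBiLipschitzWithOn L φ unitSquare ∧ HasAbsJacobianAE φ ρ.1}

theorem exists_ball_disjoint_absJacobianDensities {L r : ℝ} (hL : 1 ≤ L) (hr : 0 < r)
    (ρ₀ : PositiveDensity) : ∃ ρ₁ : PositiveDensity, dist ρ₁ ρ₀ < r ∧ ∃ δ > 0,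
      Disjoint (Metric.ball ρ₁ δ) (absJacobianDensities L) := by
  have : Nonempty unitSquare := ⟨⟨0, zero_mem_unitSquare⟩⟩
  obtain ⟨x₀, -, hx₀⟩ := isCompact_univ.exists_isMinOn Set.univ_nonempty
    ρ₀.1.continuous.continuousOn
  have hx₀' : ∀ x, ρ₀.1 x₀ ≤ ρ₀.1 x := fun x => hx₀ (Set.mem_univ x)
  have hpos := ρ₀.2 x₀
  -- Half of the minimum of the density keeps the perturbed density positive.
  set ε := min (ρ₀.1 x₀ / 2) (r / 2) with hε
  have hε0 : 0 < ε := lt_min (by linarith) (by linarith)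
  have hε1 : ε ≤ ρ₀.1 x₀ / 2 := min_le_left _ _
  have hε2 : ε ≤ r / 2 := min_le_right _ _
  obtain ⟨σ, hσ, hσε, δ, hδ, hno⟩ := exists_density_forall_not_realizesDensity (L := L)
    (ε := ε) (M := ‖ρ₀.1‖ + ε) (ρ₀ := fun x => ρ₀.1 (clampSquare x)) hL hε0
    (by linarith [norm_nonneg ρ₀.1]) (ρ₀.1.continuous.comp continuous_clampSquare)
    (fun x _ => by
      have := (le_abs_self _).trans (ρ₀.1.norm_coe_le_norm (clampSquare x))
      linarith)
  have hσρ : ∀ x : unitSquare, |σ x - ρ₀.1 x| ≤ ε := fun x => by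
    simpa only [clampSquare_coe] using hσε x x.2
  refine ⟨⟨⟨fun x => σ x, hσ.comp continuous_subtype_val⟩, fun x => ?_⟩, ?_,
    δ / (volume.real unitSquare + 1), by positivity, ?_⟩
  · have h1 := abs_le.mp (hσρ x)
    have h2 := hx₀' x
    simp only [ContinuousMap.coe_mk]
    linarith
  · rw [Subtype.dist_eq]
    refine lt_of_le_of_lt ((ContinuousMap.dist_le hε0.le).mpr fun x => ?_)
      (by linarith : ε < r)
    exact hσρ x
  · rw [Set.disjoint_left]
    rintro ρ hρ ⟨φ, hφ, hJ⟩
    have hL0 : 0 < L := zero_lt_one.trans_le hL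
    have hcont : Continuous fun x => ρ.1 (clampSquare x) :=
      ρ.1.continuous.comp continuous_clampSquare
    have hreal := realizesDensity_of_hasAbsJacobianAE hL0 hφ hJ hcont
      fun x => by rw [clampSquare_coe]
    -- A density in the ball changes integrals over subsets of the square by at most `δ`, so its
    -- realization would be an approximate realization of `σ`.
    refine hno φ hφ fun E hE hEm => ?_
    refine (hreal.of_abs_sub_le hcont hσ (S := Set.univ)
      (c := δ / (volume.real unitSquare + 1)) (by positivity) ?_ (by simp) E hE hEm).trans ?_
    · rintro x ⟨hx, -⟩
      have h1 := (ContinuousMap.dist_apply_le_dist (f := ρ.1) (g := ⟨fun x => σ x,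
        hσ.comp continuous_subtype_val⟩) (⟨x, hx⟩ : unitSquare)).trans (Metric.mem_ball.mp hρ).le
      have h2 : clampSquare x = ⟨x, hx⟩ := clampSquare_coe ⟨x, hx⟩
      rw [h2]
      exact h1
    · rw [zero_add, Set.inter_univ, div_mul_eq_mul_div, div_le_iff₀ (by positivity)]
      linarith

theorem compl_absJacobianDensities_mem_residual {L : ℝ} (hL : 1 ≤ L) :
    (absJacobianDensities L)ᶜ ∈ residual PositiveDensity := by
  refine Filter.mem_of_superset (residual_of_dense_open (s := (closure (absJacobianDensities L))ᶜ)
    isClosed_closure.isOpen_compl ?_) (Set.compl_subset_compl.mpr subset_closure)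
  rw [Metric.dense_iff]
  intro ρ₀ r hr
  obtain ⟨ρ₁, h, δ, hδ, hdisj⟩ := exists_ball_disjoint_absJacobianDensities hL hr ρ₀
  refine ⟨ρ₁, h, fun hc => ?_⟩
  obtain ⟨ρ, hρ, hd⟩ := Metric.mem_closure_iff.mp hc δ hδ
  exact Set.disjoint_left.mp hdisj (Metric.mem_ball'.mpr hd) hρ

theorem IsBiLipschitzWithOn.of_le {L L' : ℝ} {φ : Plane → Plane} {s : Set Plane} (hL : 0 < L)
    (hLL' : L ≤ L') (h : IsBiLipschitzWithOn L φ s) : IsBiLipschitzWithOn L' φ s :=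
  fun x hx y hy =>
    ⟨(mul_le_mul_of_nonneg_right (one_div_le_one_div_of_le hL hLL') dist_nonneg).trans
      (h x hx y hy).1,
    (h x hx y hy).2.trans (mul_le_mul_of_nonneg_right hLL' dist_nonneg)⟩

theorem nonAbsJacobian_mem_residual : nonAbsJacobian ∈ residual PositiveDensity := by
  have h : ⋂ n : ℕ, (absJacobianDensities (n + 1))ᶜ ∈ residual PositiveDensity :=
    countable_iInter_mem.mpr fun n => compl_absJacobianDensities_mem_residual (by simp)
  refine Filter.mem_of_superset h ?_
  rintro ρ hρ ⟨φ, ⟨L, hL, hφ⟩, hJ⟩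
  obtain ⟨n, hn⟩ := exists_nat_ge L
  exact Set.mem_iInter.mp hρ n
    ⟨φ, hφ.of_le (by linarith) (by linarith), hJ⟩

/-- Since `ρ` is positive, a signed Jacobian equal to `ρ` is also the unsigned one. The unsigned
statement is thus the stronger. -/
theorem nonAbsJacobian_subset_nonJacobian : nonAbsJacobian ⊆ nonJacobian := by
  rintro ρ hρ ⟨φ, hφ, hJ⟩
  refine hρ ⟨φ, hφ, ?_⟩
  filter_upwards [hJ] with x hx hxs
  obtain ⟨A, hA, hdet⟩ := hx hxs
  exact ⟨A, hA, by rw [hdet, abs_of_pos (ρ.2 _)]⟩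

theorem theorem1 :
    nonJacobian ∈ residual PositiveDensity ∧ nonAbsJacobian ∈ residual PositiveDensity :=
  ⟨Filter.mem_of_superset nonAbsJacobian_mem_residual nonAbsJacobian_subset_nonJacobian,
    nonAbsJacobian_mem_residual⟩
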